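/- Define the density $d(X)$ of a topological space $X$ to be the least infinite cardinal $\kappa$ such that $X$ has a dense subset of size at most $\kappa$. Define the Noetherian type $\mathrm{Nt}(X)$ to be the least infinite cardinal $\kappa$ such that $X$ has a base $\mathcal B$ in which every element has fewer than $\kappa$ supersets belonging to $\mathcal B$. Let $X=\prod_{i\in I}X_i$ be a product of linearly ordered topological spaces $X_i$ (with their order topologies), each of which is compact. (1) If $\kappa$ is a regular uncountable cardinal, $|I|<\kappa$ and $\mathrm{Nt}(X)\le\kappa$, then $d(X)<\kappa$. (2) If $|I|\le \mathrm{Nt}(X)$, then $d(X)\le \mathrm{Nt}(X)$. (3) If $|I|<\mathrm{Nt}(X)$ and $d(X)=\mathrm{Nt}(X)$, then $\mathrm{Nt}(X)$ is either $\aleph_0$ or a singular cardinal. -/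

import Mathlib

open Cardinal Set TopologicalSpace

universe u

/-- A preorder is `κ`-op-like if no element lies below `κ`-many elements. -/
def IsOpLike (κ : Cardinal.{u}) (P : Type u) [Preorder P] : Prop :=
  ∀ p : P, #{q : P // p ≤ q} < κ

/-- The Noetherian type of a space: the least infinite cardinal `κ` such that the space has a base
that is `κ`-op-like, when ordered by inclusion. -/
noncomputable def noetherianType (X : Type u) [TopologicalSpace X] : Cardinal.{u} :=
  sInf {κ : Cardinal.{u} | ℵ₀ ≤ κ ∧ ∃ B : Set (Set X), IsTopologicalBasis B ∧ IsOpLike κ B}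

/-- The density of a space: the least infinite cardinal `κ` such that the space has a dense subset
of size at most `κ`. -/
noncomputable def topDensity (X : Type u) [TopologicalSpace X] : Cardinal.{u} :=
  sInf {κ : Cardinal.{u} | ℵ₀ ≤ κ ∧ ∃ D : Set X, Dense D ∧ #D ≤ κ}

/-- The infimum in the definition of the Noetherian type is attained. -/
theorem noetherianType_spec (X : Type u) [TopologicalSpace X] :
    ℵ₀ ≤ noetherianType X ∧
      ∃ B : Set (Set X), IsTopologicalBasis B ∧ IsOpLike (noetherianType X) B := by
  have h : {κ : Cardinal.{u} | ℵ₀ ≤ κ ∧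
      ∃ B : Set (Set X), IsTopologicalBasis B ∧ IsOpLike κ B}.Nonempty := by
    refine ⟨Order.succ (max ℵ₀ #(Set X)), (le_max_left _ _).trans (Order.le_succ _),
      {U | IsOpen U}, isTopologicalBasis_opens, fun p => ?_⟩
    refine Order.lt_succ_of_le (le_trans ?_ (le_max_right _ _))
    exact (mk_subtype_le _).trans (mk_subtype_le _)
  exact csInf_mem h

/-- The infimum in the definition of the density is attained. -/
theorem topDensity_spec (X : Type u) [TopologicalSpace X] :
    ℵ₀ ≤ topDensity X ∧ ∃ D : Set X, Dense D ∧ #D ≤ topDensity X := by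
  have h : {κ : Cardinal.{u} | ℵ₀ ≤ κ ∧ ∃ D : Set X, Dense D ∧ #D ≤ κ}.Nonempty :=
    ⟨max ℵ₀ #X, le_max_left _ _, Set.univ, dense_univ, by simp⟩
  exact csInf_mem h

/-!
The heart of the matter is the claim about regular uncountable `κ`. The bound `d(X) ≤ Nt(X)` is this
claim for the successor of `Nt(X)`, and the claim for `Nt(X)` itself shows that `Nt(X)` is not
regular uncountable if `d(X) = Nt(X)`.

Given a regular uncountable `κ` with `|I| < κ` and `Nt(X) ≤ κ`, fix a base `B` of
`X = ∏ i, X i` in which every element has fewer than `κ` supersets.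
Every nonempty linearly ordered compactum has a point with a countable local π-base
(`exists_countable_local_pi_base`: any point if the space is finite, and otherwise a limit of
a strictly monotone sequence);
fix such a base point `x₀ i` in each factor. A closing-off argument (`exists_closed_under`) produces
a set `A` of fewer than `κ` points of the factors which plays the role of the trace of an elementary
submodel: with `c` and `d` in `A`, consider the nonempty open boxes cut out by `c`, `d` and finitely
many members of the fixed local π-bases, and for each of them one member of `B` contained in it;
then `A` contains the suprema and infima of the coordinate projections of all supersets in `B` of
that member.

Such an `A` is dense in each factor (`dense_of_isLUB_isGLB_mem`). Otherwise some point `w` outside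
the closure of `A` lies in a gap of `A`, one of whose endpoints, say the left one `a`, is not in `A`
and hence is a limit of points of `A` from the left. Take `U ∈ B` containing the point with
coordinate `a` in this factor and base points elsewhere, and lying to the left of `w`. Then `U`
contains one of the boxes above, so the supremum of its projection belongs to `A`; but it lies in
`[a, w]`, which is disjoint from `A`. Finally, the points of `X` that take values in `A` on a finite
set of coordinates and have fixed values elsewhere are dense, and there are fewer than `κ` of them.
-/

/-! ### Closing off under set-valued operations -/

theorem mk_finset_lt {α : Type u} {κ : Cardinal.{u}} (hκ : ℵ₀ < κ) (h : #α < κ) :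
    #(Finset α) < κ := by
  cases finite_or_infinite α
  · exact (mk_lt_aleph0 (α := Finset α)).trans hκ
  · rwa [mk_finset_of_infinite]

/-- A set of size less than a regular uncountable `κ` can be enlarged to one, still of size less
than `κ`, that is closed under a binary operation whose values are sets of size less than `κ`. -/
theorem exists_closed_under {T : Type u} {κ : Cardinal.{u}} (hreg : κ.IsRegular) (hκ : ℵ₀ < κ)
    (F : T → T → Set T) (hF : ∀ p q, #(F p q) < κ) (A₀ : Set T) (hA₀ : #A₀ < κ) :
    ∃ A : Set T, A₀ ⊆ A ∧ #A < κ ∧ ∀ p ∈ A, ∀ q ∈ A, F p q ⊆ A := by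
  let step : Set T → Set T := fun A => A ∪ ⋃ p : A, ⋃ q : A, F p q
  let A : ℕ → Set T := fun n => step^[n] A₀
  have hsucc : ∀ n, A (n + 1) = step (A n) := fun n => Function.iterate_succ_apply' step n A₀
  have hmono : Monotone A :=
    monotone_nat_of_le_succ fun n => by rw [hsucc]; exact subset_union_left
  have hcard : ∀ n, #(A n) < κ := by
    intro n
    induction n with
    | zero => exact hA₀
    | succ n ih =>
      rw [hsucc]
      refine (mk_union_le _ _).trans_lt (add_lt_of_lt hreg.aleph0_le ih ?_)
      rw [card_iUnion_lt_iff_forall_of_isRegular hreg ih]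
      intro p
      rw [card_iUnion_lt_iff_forall_of_isRegular hreg ih]
      exact fun q => hF p q
  refine ⟨⋃ n : ULift.{u} ℕ, A n.down, subset_iUnion_of_subset ⟨0⟩ subset_rfl, ?_, ?_⟩
  · rw [card_iUnion_lt_iff_forall_of_isRegular hreg (by simpa using hκ)]
    exact fun n => hcard n.down
  · intro p hp q hq t ht
    simp only [mem_iUnion, ULift.exists] at hp hq ⊢
    obtain ⟨m, hm⟩ := hp
    obtain ⟨n, hn⟩ := hq
    refine ⟨max m n + 1, ?_⟩
    rw [hsucc]
    refine Or.inr (mem_iUnion.2 ⟨⟨p, hmono (le_max_left _ _) hm⟩, mem_iUnion.2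
      ⟨⟨q, hmono (le_max_right _ _) hn⟩, ht⟩⟩)

/-! ### Linearly ordered compacta -/

section LinearOrder

variable {X : Type u} [LinearOrder X]

theorem finite_setOf_isLUB_or_isGLB (S : Set X) : {s | IsLUB S s ∨ IsGLB S s}.Finite :=
  Set.Finite.union (Set.Subsingleton.finite fun _ hx _ hy => IsLUB.unique hx hy)
    (Set.Subsingleton.finite fun _ hx _ hy => IsGLB.unique hx hy)

variable [TopologicalSpace X] [OrderTopology X] [CompactSpace X]

theorem exists_isLUB_of_compactSpace {S : Set X} (hS : S.Nonempty) : ∃ s, IsLUB S s := by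
  obtain ⟨s, -, hs⟩ := (isClosed_closure (s := S)).isCompact.exists_isLUB hS.closure
  exact ⟨s, by rwa [IsLUB, upperBounds_closure] at hs⟩

/-- The supremum of a strictly increasing sequence has a countable local π-base, formed by the
intervals between terms of the sequence two steps apart. -/
theorem exists_countable_local_pi_base_of_strictMono {y : ℕ → X} (hy : StrictMono y) :
    ∃ (x : X) (Q : ℕ → Set X), (∀ n, IsOpen (Q n) ∧ (Q n).Nonempty) ∧
      ∀ N ∈ nhds x, ∃ n, Q n ⊆ N := by
  obtain ⟨x, hx⟩ := exists_isLUB_of_compactSpace (range_nonempty y)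
  refine ⟨x, fun n => Ioo (y n) (y (n + 2)),
    fun n => ⟨isOpen_Ioo, y (n + 1), hy (by omega), hy (by omega)⟩, fun N hN => ?_⟩
  have hlt : ∀ n, y n < x := fun n => (hy n.lt_succ_self).trans_le (hx.1 ⟨n + 1, rfl⟩)
  obtain ⟨l, hl, hlN⟩ := exists_Ioc_subset_of_mem_nhds hN ⟨y 0, hlt 0⟩
  obtain ⟨_, ⟨n, rfl⟩, hn⟩ := (lt_isLUB_iff hx).1 hl
  exact ⟨n, fun z hz => hlN ⟨hn.trans hz.1, (hz.2.trans (hlt _)).le⟩⟩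

theorem exists_countable_local_pi_base [Nonempty X] :
    ∃ (x : X) (Q : ℕ → Set X), (∀ n, IsOpen (Q n) ∧ (Q n).Nonempty) ∧
      ∀ N ∈ nhds x, ∃ n, Q n ⊆ N := by
  cases finite_or_infinite X
  · obtain ⟨x⟩ := ‹Nonempty X›
    exact ⟨x, fun _ => {x}, fun _ => ⟨isOpen_discrete _, singleton_nonempty x⟩,
      fun N hN => ⟨0, singleton_subset_iff.2 (mem_of_mem_nhds hN)⟩⟩
  · obtain ⟨g, hg | hg⟩ :=
      exists_increasing_or_nonincreasing_subseq (· < ·) (Infinite.natEmbedding X)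
    · exact exists_countable_local_pi_base_of_strictMono (y := fun n => _)
        (fun m n h => hg m n h)
    · have : CompactSpace Xᵒᵈ := ‹CompactSpace X›
      refine exists_countable_local_pi_base_of_strictMono (X := Xᵒᵈ)
        (y := fun n => OrderDual.toDual (Infinite.natEmbedding X (g n))) fun m n h => ?_
      refine OrderDual.toDual_lt_toDual.2 (lt_of_le_of_ne (not_lt.1 (hg m n h)) ?_)
      exact fun e => h.ne' (g.injective ((Infinite.natEmbedding X).injective e))

/-- If `w` is not in the closure of `A`, then the left endpoint of the gap of `A` around `w` belongs
to `A`, provided that every limit point `a` of intervals with endpoints in `A` has arbitrarily small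
sets around it whose suprema are in `A`. -/
theorem mem_of_isLUB_inter_Iio {A : Set X}
    (H : ∀ a, ∀ N, IsOpen N → a ∈ N →
      (∀ N' ∈ nhds a, ∃ c ∈ A, ∃ d ∈ A, (Ioo c d).Nonempty ∧ Ioo c d ⊆ N') →
      ∃ U ⊆ N, a ∈ U ∧ ∀ s, IsLUB U s → s ∈ A)
    {w a : X} (hw : w ∉ closure A) (hne : (A ∩ Iio w).Nonempty) (ha : IsLUB (A ∩ Iio w) a) :
    a ∈ A := by
  by_contra haA
  have haw : a < w := by
    refine lt_of_le_of_ne (ha.2 fun c hc => hc.2.le) ?_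
    rintro rfl
    exact hw (closure_mono inter_subset_left (ha.mem_closure hne))
  have hlt : ∀ c ∈ A ∩ Iio w, c < a := fun c hc =>
    lt_of_le_of_ne (ha.1 hc) fun h => haA (h ▸ hc.1)
  obtain ⟨U, hUw, haU, hU⟩ := H a (Iio w) isOpen_Iio haw fun N' hN' => by
    obtain ⟨l, hl⟩ := hne
    obtain ⟨l', hl', hN⟩ := exists_Ioc_subset_of_mem_nhds hN' ⟨l, hlt l hl⟩
    obtain ⟨c, hc, hlc⟩ := (lt_isLUB_iff ha).1 hl'
    obtain ⟨d, hd, hcd⟩ := (lt_isLUB_iff ha).1 (hlt c hc)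
    obtain ⟨e, he, hde⟩ := (lt_isLUB_iff ha).1 (hlt d hd)
    exact ⟨c, hc.1, e, he.1, ⟨d, hcd, hde⟩,
      fun z hz => hN ⟨hlc.trans hz.1, (hz.2.trans (hlt e he)).le⟩⟩
  obtain ⟨s, hs⟩ := exists_isLUB_of_compactSpace ⟨a, haU⟩
  have hsA : s ∈ A := hU s hs
  have hsw : s < w := lt_of_le_of_ne (hs.2 fun u hu => (hUw hu).le)
    fun h => hw (subset_closure (h ▸ hsA))
  exact (hlt s ⟨hsA, hsw⟩).not_ge (hs.1 haU)

/-- A density criterion for subsets of a linearly ordered compactum. The last hypothesis makes the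
endpoints of every gap of `A` belong to `A`, and the second one then rules out nonempty gaps. -/
theorem dense_of_isLUB_isGLB_mem {A : Set X}
    (huniv : ∀ s, IsLUB univ s ∨ IsGLB univ s → s ∈ A)
    (hmid : ∀ c ∈ A, ∀ d ∈ A, (Ioo c d).Nonempty → (Ioo c d ∩ A).Nonempty)
    (H : ∀ a, ∀ N, IsOpen N → a ∈ N →
      (∀ N' ∈ nhds a, ∃ c ∈ A, ∃ d ∈ A, (Ioo c d).Nonempty ∧ Ioo c d ⊆ N') →
      ∃ U ⊆ N, a ∈ U ∧ ∀ s, IsLUB U s ∨ IsGLB U s → s ∈ A) :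
    Dense A := by
  have : CompactSpace Xᵒᵈ := ‹CompactSpace X›
  intro w
  by_contra hw
  have hwA : w ∉ A := fun h => hw (subset_closure h)
  obtain ⟨t, ht⟩ := exists_isLUB_of_compactSpace (S := (univ : Set X)) ⟨w, trivial⟩
  obtain ⟨b, hb⟩ := exists_isLUB_of_compactSpace (X := Xᵒᵈ) (S := (univ : Set X)) ⟨w, trivial⟩
  have hbA : b ∈ A := huniv b (Or.inr hb)
  have htA : t ∈ A := huniv t (Or.inl ht)
  have hL : (A ∩ Iio w).Nonempty :=
    ⟨b, hbA, lt_of_le_of_ne (hb.1 (mem_univ w)) fun h => hwA (h ▸ hbA)⟩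
  have hR : (A ∩ Ioi w).Nonempty :=
    ⟨t, htA, lt_of_le_of_ne (ht.1 (mem_univ w)) fun h => hwA (h ▸ htA)⟩
  obtain ⟨c, hc⟩ := exists_isLUB_of_compactSpace hL
  obtain ⟨d, hd⟩ : ∃ d, IsGLB (A ∩ Ioi w) d := exists_isLUB_of_compactSpace (X := Xᵒᵈ) hR
  have hcA : c ∈ A := by
    refine mem_of_isLUB_inter_Iio (fun a N hN ha h => ?_) hw hL hc
    obtain ⟨U, hUN, haU, hU⟩ := H a N hN ha h
    exact ⟨U, hUN, haU, fun s hs => hU s (Or.inl hs)⟩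
  have hdA : d ∈ A := by
    refine mem_of_isLUB_inter_Iio (X := Xᵒᵈ) (A := A) (fun a N hN ha h => ?_) hw hR hd
    obtain ⟨U, hUN, haU, hU⟩ := H a N hN ha fun N' hN' => by
      obtain ⟨c, hc, d, hd, ⟨z, hz⟩, hN⟩ := h N' hN'
      exact ⟨d, hd, c, hc, ⟨z, hz.2, hz.1⟩, fun z hz => hN ⟨hz.2, hz.1⟩⟩
    exact ⟨U, hUN, haU, fun s hs => hU s (Or.inr hs)⟩
  have hcw : c < w := lt_of_le_of_ne (hc.2 fun z hz => hz.2.le) fun h => hwA (h ▸ hcA)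
  have hwd : w < d := lt_of_le_of_ne (hd.2 fun z hz => hz.2.le) fun h => hwA (h ▸ hdA)
  obtain ⟨z, hz, hzA⟩ := hmid c hcA d hdA ⟨w, hcw, hwd⟩
  rcases lt_trichotomy z w with h | rfl | h
  · exact hz.1.not_ge (hc.1 ⟨hzA, h⟩)
  · exact hwA hzA
  · exact hz.2.not_ge (hd.1 ⟨hzA, h⟩)

end LinearOrder

/-! ### Density of products -/

theorem topDensity_lt_of_dense {X : Type u} [TopologicalSpace X] {κ : Cardinal.{u}} (hκ : ℵ₀ < κ)
    {D : Set X} (hD : Dense D) (hcard : #D < κ) : topDensity X < κ := by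
  have h : topDensity X ≤ max ℵ₀ #D := csInf_le' ⟨le_max_left _ _, D, hD, le_max_right _ _⟩
  exact h.trans_lt (max_lt hκ hcard)

theorem topDensity_pi_lt {I : Type u} {X : I → Type u} [∀ i, TopologicalSpace (X i)]
    [∀ i, Nonempty (X i)] {κ : Cardinal.{u}} (hκ : ℵ₀ < κ) {A : Set (Σ i, X i)} (hA : #A < κ)
    (hdense : ∀ i, Dense {a : X i | (⟨i, a⟩ : Σ i, X i) ∈ A}) : topDensity (∀ i, X i) < κ := by
  classical
  -- A finite set of points of the factors codes the point of the product through these points,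
  -- with arbitrary fixed values in the other coordinates.
  let f : Finset A → ∀ i, X i := fun s i =>
    if h : ∃ a : X i, ∃ p ∈ s, p.1 = ⟨i, a⟩ then h.choose else Classical.arbitrary (X i)
  refine topDensity_lt_of_dense hκ (D := range f) ?_
    (mk_range_le.trans_lt (mk_finset_lt hκ hA))
  refine dense_iff_inter_open.2 fun U hU ⟨x, hx⟩ => ?_
  obtain ⟨J, u, hu, hJU⟩ := isOpen_pi_iff.1 hU x hx
  have hex : ∀ i : I, ∃ a : X i, (⟨i, a⟩ : Σ i, X i) ∈ A ∧ (i ∈ J → a ∈ u i) := by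
    intro i
    by_cases hi : i ∈ J
    · obtain ⟨a, ha, haA⟩ := (hdense i).inter_open_nonempty (u i) (hu i hi).1 ⟨_, (hu i hi).2⟩
      exact ⟨a, haA, fun _ => ha⟩
    · obtain ⟨a, haA⟩ := (hdense i).nonempty
      exact ⟨a, haA, fun h => absurd h hi⟩
  choose g hgA hgu using hex
  refine ⟨f (J.image fun i => ⟨⟨i, g i⟩, hgA i⟩), hJU fun i hi => ?_, mem_range_self _⟩
  have h : ∃ a : X i, ∃ p ∈ J.image (fun i => (⟨⟨i, g i⟩, hgA i⟩ : A)), p.1 = ⟨i, a⟩ :=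
    ⟨g i, _, Finset.mem_image_of_mem _ hi, rfl⟩
  have hval : f (J.image fun i => ⟨⟨i, g i⟩, hgA i⟩) i = g i := by
    simp only [f]
    rw [dif_pos h]
    obtain ⟨p, hp, hpe⟩ := h.choose_spec
    obtain ⟨j, -, rfl⟩ := Finset.mem_image.1 hp
    obtain ⟨rfl, h'⟩ := Sigma.mk.inj hpe
    exact (eq_of_heq h').symm
  rw [hval]
  exact hgu i hi

/-! ### Products of linearly ordered compacta -/

theorem exists_isOpLike_of_noetherianType_le {X : Type u} [TopologicalSpace X] {κ : Cardinal.{u}}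
    (h : noetherianType X ≤ κ) : ∃ B : Set (Set X), IsTopologicalBasis B ∧ IsOpLike κ B := by
  obtain ⟨-, B, hB, hop⟩ := noetherianType_spec X
  exact ⟨B, hB, fun p => (hop p).trans_le h⟩

section Pi

variable {I : Type u} {X : I → Type u} [∀ i, LinearOrder (X i)]

/-- The box in a product cut out by a lower bound `p`, an upper bound `q` (each on its own
coordinate), and the members of the families `Q i` indexed by the finite set `J`. -/
def piBox (Q : ∀ i, ℕ → Set (X i)) (p q : Σ i, X i) (J : Finset (I × ℕ)) : Set (∀ i, X i) :=
  {x | p.2 < x p.1 ∧ x q.1 < q.2 ∧ ∀ k ∈ J, x k.1 ∈ Q k.1 k.2}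

variable [∀ i, TopologicalSpace (X i)]

theorem isOpen_piBox [∀ i, OrderTopology (X i)] {Q : ∀ i, ℕ → Set (X i)}
    (hQ : ∀ i n, IsOpen (Q i n)) (p q : Σ i, X i)
    (J : Finset (I × ℕ)) : IsOpen (piBox Q p q J) := by
  refine (isOpen_Ioi.preimage (continuous_apply p.1)).inter
    ((isOpen_Iio.preimage (continuous_apply q.1)).inter ?_)
  have : {x : ∀ i, X i | ∀ k ∈ J, x k.1 ∈ Q k.1 k.2} =
      ⋂ k ∈ J, (fun x : ∀ i, X i => x k.1) ⁻¹' Q k.1 k.2 := by ext; simp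
  change IsOpen {x : ∀ i, X i | ∀ k ∈ J, x k.1 ∈ Q k.1 k.2}
  rw [this]
  exact isOpen_biInter_finset fun k _ => (hQ k.1 k.2).preimage (continuous_apply k.1)

/-- If every neighbourhood of `a` contains a nonempty interval with endpoints in `A`, then every
neighbourhood of the point with `i`-th coordinate `a` and base points elsewhere contains a nonempty
box bounded by elements of `A`. -/
theorem exists_piBox_subset {x₀ : ∀ i, X i} {Q : ∀ i, ℕ → Set (X i)}
    (hQne : ∀ i n, (Q i n).Nonempty) (hQ : ∀ i, ∀ N ∈ nhds (x₀ i), ∃ n, Q i n ⊆ N)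
    [DecidableEq I] {i : I} {a : X i} {A : Set (X i)}
    (ha : ∀ N ∈ nhds a, ∃ c ∈ A, ∃ d ∈ A, (Ioo c d).Nonempty ∧ Ioo c d ⊆ N)
    {U : Set (∀ i, X i)} (hU : IsOpen U) (hxU : Function.update x₀ i a ∈ U) :
    ∃ c ∈ A, ∃ d ∈ A, ∃ J, (piBox Q ⟨i, c⟩ ⟨i, d⟩ J).Nonempty ∧ piBox Q ⟨i, c⟩ ⟨i, d⟩ J ⊆ U := by
  obtain ⟨F, u, hu, hFU⟩ := isOpen_pi_iff.1 hU _ hxU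
  obtain ⟨c, hc, d, hd, ⟨z, hz⟩, hcd⟩ := ha {y | i ∈ F → y ∈ u i} <| by
    by_cases hi : i ∈ F
    · simpa [hi] using (hu i hi).1.mem_nhds (by simpa using (hu i hi).2)
    · simp [hi]
  have hn : ∀ j, ∃ n, j ∈ F → j ≠ i → Q j n ⊆ u j := by
    intro j
    by_cases hj : j ∈ F ∧ j ≠ i
    · have hxj := (hu j hj.1).2
      rw [Function.update_of_ne hj.2] at hxj
      obtain ⟨n, hn⟩ := hQ j (u j) ((hu j hj.1).1.mem_nhds hxj)
      exact ⟨n, fun _ _ => hn⟩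
    · exact ⟨0, fun h h' => absurd ⟨h, h'⟩ hj⟩
  choose n hn using hn
  refine ⟨c, hc, d, hd, (F.erase i).image fun j => (j, n j), ?_, ?_⟩
  · refine ⟨Function.update (fun j => (hQne j (n j)).some) i z, ?_, ?_, ?_⟩
    · simpa using hz.1
    · simpa using hz.2
    · intro k hk
      obtain ⟨j, hj, rfl⟩ := Finset.mem_image.1 hk
      rw [Function.update_of_ne (Finset.ne_of_mem_erase hj)]
      exact (hQne j (n j)).some_mem
  · rintro y ⟨hcy, hyd, hy⟩
    refine hFU fun j hj => ?_
    by_cases hji : j = i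
    · subst hji
      exact hcd ⟨hcy, hyd⟩ hj
    · exact hn j hj hji (hy (j, n j)
        (Finset.mem_image_of_mem _ (Finset.mem_erase.2 ⟨hji, hj⟩)))

/-- The closing-off argument. Each nonempty box contains a member `V` of `B`, and `V` has fewer than
`κ` supersets in `B`; this is what keeps the set closed under taking the extrema of the projections
of these supersets small. -/
theorem topDensity_pi_lt_of_isOpLike [∀ i, OrderTopology (X i)] [∀ i, CompactSpace (X i)]
    {κ : Cardinal.{u}}
    (hreg : κ.IsRegular) (hκ : ℵ₀ < κ) (hI : #I < κ) {B : Set (Set (∀ i, X i))}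
    (hB : IsTopologicalBasis B) (hop : IsOpLike κ B) : topDensity (∀ i, X i) < κ := by
  classical
  rcases isEmpty_or_nonempty (∀ i, X i) with hX | hX
  · exact topDensity_lt_of_dense hκ (D := ∅) (fun x => hX.elim x)
      (by simpa using aleph0_pos.trans hκ)
  have hne : ∀ i, Nonempty (X i) := fun i => hX.map fun x => x i
  choose x₀ Q hQo hQ using fun i => exists_countable_local_pi_base (X := X i)
  have hV : ∀ p q J, ∃ V : B, (piBox Q p q J).Nonempty → V.1 ⊆ piBox Q p q J := by
    intro p q J
    by_cases h : (piBox Q p q J).Nonempty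
    · obtain ⟨x, hx⟩ := h
      obtain ⟨V, hVB, -, hV⟩ :=
        hB.exists_subset_of_mem_open hx (isOpen_piBox (fun i n => (hQo i n).1) p q J)
      exact ⟨⟨V, hVB⟩, fun _ => hV⟩
    · obtain ⟨V, hVB, -⟩ :=
        hB.exists_subset_of_mem_open (mem_univ (Classical.arbitrary (∀ i, X i))) isOpen_univ
      exact ⟨⟨V, hVB⟩, fun h' => absurd h' h⟩
  choose V hV using hV
  have hpt : ∀ p q, ∃ x, (piBox Q p q ∅).Nonempty → x ∈ piBox Q p q ∅ := by
    intro p q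
    by_cases h : (piBox Q p q ∅).Nonempty
    · exact ⟨h.some, fun _ => h.some_mem⟩
    · exact ⟨Classical.arbitrary _, fun h' => absurd h' h⟩
  choose pt hpt using hpt
  have hext : ∀ (i : I) (S : Set (X i)),
      #(Sigma.mk i '' {s | IsLUB S s ∨ IsGLB S s} : Set (Σ i, X i)) < κ := fun i S =>
    (((finite_setOf_isLUB_or_isGLB S).image _).lt_aleph0).trans hκ
  -- `ULift` only serves to keep all index types of the unions in the universe of `κ`.
  obtain ⟨A, hA₀, hAκ, hA⟩ := exists_closed_under hreg hκ
    (fun p q => (⋃ J : Finset (I × ULift.{u} ℕ),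
        ⋃ U : {U : B // V p q (J.image fun k => (k.1, k.2.down)) ≤ U},
        ⋃ i, Sigma.mk i '' {s | IsLUB ((fun x : ∀ i, X i => x i) '' U.1.1) s ∨
          IsGLB ((fun x : ∀ i, X i => x i) '' U.1.1) s}) ∪
      range fun i => (⟨i, pt p q i⟩ : Σ i, X i))
    (fun p q => by
      refine (mk_union_le _ _).trans_lt
        (add_lt_of_lt hreg.aleph0_le ?_ (mk_range_le.trans_lt hI))
      have hJ : #(Finset (I × ULift.{u} ℕ)) < κ := by
        refine mk_finset_lt hκ ?_
        rw [mk_prod, lift_id, lift_id]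
        exact mul_lt_of_lt hreg.aleph0_le hI (by simpa using hκ)
      rw [card_iUnion_lt_iff_forall_of_isRegular hreg hJ]
      intro J
      rw [card_iUnion_lt_iff_forall_of_isRegular hreg (hop _)]
      intro U
      rw [card_iUnion_lt_iff_forall_of_isRegular hreg hI]
      exact fun i => hext i _)
    (⋃ i, Sigma.mk i '' {s | IsLUB univ s ∨ IsGLB univ s})
    ((card_iUnion_lt_iff_forall_of_isRegular hreg hI).2 fun i => hext i _)
  refine topDensity_pi_lt hκ hAκ fun i => dense_of_isLUB_isGLB_mem ?_ ?_ ?_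
  · exact fun s hs => hA₀ (mem_iUnion.2 ⟨i, s, hs, rfl⟩)
  · rintro c hc d hd ⟨z, hz⟩
    have hmem := hpt ⟨i, c⟩ ⟨i, d⟩
      ⟨Function.update x₀ i z, by simpa using hz.1, by simpa using hz.2, by simp⟩
    exact ⟨pt ⟨i, c⟩ ⟨i, d⟩ i, ⟨hmem.1, hmem.2.1⟩, hA _ hc _ hd (Or.inr ⟨i, rfl⟩)⟩
  · intro a N hN haN ha
    obtain ⟨U, hUB, hxU, hUN⟩ := hB.exists_subset_of_mem_open
      (a := Function.update x₀ i a) (u := (fun x : ∀ i, X i => x i) ⁻¹' N)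
      (by simpa using haN) (hN.preimage (continuous_apply i))
    obtain ⟨c, hc, d, hd, J, hJne, hJ⟩ :=
      exists_piBox_subset (fun i n => (hQo i n).2) hQ ha (hB.isOpen hUB) hxU
    refine ⟨(fun x : ∀ i, X i => x i) '' U, image_subset_iff.2 hUN,
      ⟨_, hxU, by simp⟩, fun s hs => hA _ hc _ hd (Or.inl ?_)⟩
    have hJ' : (J.image fun k => (k.1, ULift.up.{u} k.2)).image
        (fun k => (k.1, k.2.down)) = J := by
      simp [Finset.image_image, Function.comp_def]
    refine mem_iUnion.2 ⟨J.image fun k => (k.1, ULift.up k.2), mem_iUnion.2 ⟨⟨⟨U, hUB⟩, ?_⟩,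
      mem_iUnion.2 ⟨i, s, hs, rfl⟩⟩⟩
    rw [hJ']
    exact (hV _ _ J hJne).trans hJ

end Pi

theorem mainTheorem2 {I : Type u} (X : I → Type u)
    [∀ i, LinearOrder (X i)] [∀ i, TopologicalSpace (X i)] [∀ i, OrderTopology (X i)]
    [∀ i, CompactSpace (X i)] :
    (∀ κ : Cardinal.{u}, κ.IsRegular → ℵ₀ < κ → #I < κ →
      noetherianType (∀ i, X i) ≤ κ → topDensity (∀ i, X i) < κ) ∧
    (#I ≤ noetherianType (∀ i, X i) →
      topDensity (∀ i, X i) ≤ noetherianType (∀ i, X i)) ∧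
    (#I < noetherianType (∀ i, X i) →
      topDensity (∀ i, X i) = noetherianType (∀ i, X i) →
      noetherianType (∀ i, X i) = ℵ₀ ∨ (noetherianType (∀ i, X i)).IsSingular) := by
  have key : ∀ κ : Cardinal.{u}, κ.IsRegular → ℵ₀ < κ → #I < κ →
      noetherianType (∀ i, X i) ≤ κ → topDensity (∀ i, X i) < κ := by
    intro κ hreg hκ hI hNt
    obtain ⟨B, hB, hop⟩ := exists_isOpLike_of_noetherianType_le hNt
    exact topDensity_pi_lt_of_isOpLike hreg hκ hI hB hop
  have hNt : ℵ₀ ≤ noetherianType (∀ i, X i) := (noetherianType_spec _).1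
  refine ⟨key, fun hI => ?_, fun hI hd => ?_⟩
  · exact Order.lt_succ_iff.1 (key _ (isRegular_succ hNt) (Order.lt_succ_of_le hNt)
      (Order.lt_succ_of_le hI) (Order.le_succ _))
  · rcases hNt.eq_or_lt with h | h
    · exact Or.inl h.symm
    · exact Or.inr (.of_not_isRegular hNt fun hreg => (key _ hreg h hI le_rfl).ne hd)
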